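/- Let $p$ be a prime, $N\ge 1$ an integer, $\mathcal A_N=\{1,\dots,N\}$, and let $w=a_1a_2a_3\ldots\in\mathcal A_N^{\mathbb N}$ be an infinite word; let $w_n=a_1\ldots a_n$ be its prefix of length $n$ and $\mathrm T w=a_2a_3\ldots$ the shift. For a letter $a$ put $A_a=\begin{pmatrix}0&1\\1&a\end{pmatrix}$, and for a finite word $u=u_1\ldots u_n$ put $A_u=A_{u_1}\cdots A_{u_n}$ (the identity for the empty word). On pairs $(w,\mathbf x_p)$ with $\mathbf x_p\in\mathbf P^1_{\mathbb Q_p}$ let $\mathrm T(w,\mathbf x_p)=(\mathrm Tw,A_{a_1}\mathbf x_p)$. For $\epsilon>0$ let $\mathbf{PBad}_\epsilon$ be the set of all $(q_1:q_2)\in\mathbf P^1_{\mathbb Q_p}$ such that $$|aq_1+bq_2|_p\cdot\min\{|q_1|_p^{-1},|q_2|_p^{-1}\}\ \ge\ \epsilon\cdot\min\{|a|^{-2},|b|^{-2}\}\qquad\text{for all }(a,b)\in\mathbb Z^2\setminus\{(0,0)\}$$ (with $0^{-1}=\infty$), and let $\mathbf{LMad}$ be the set of pairs $(w,\mathbf x_p)$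 for which there is an $\epsilon>0$ such that $\mathrm T^n(w,\mathbf x_p)\in\mathcal A_M^{\mathbb N}\times\mathbf{PBad}_\epsilon$ for every $n\ge 1$, where $M=[\epsilon^{-1}]+1$. Let $\mathrm{SL}_2^{\pm}(\mathbb Z_p)$ be the set of $2\times2$ matrices over $\mathbb Z_p$ with determinant $\pm1$. For $A\in\mathrm{SL}_2^{\pm}(\mathbb Z_p)$ with two different eigenvectors in $\mathbf P^1_{\overline{\mathbb Q}_p}$ let $\kappa(A)$ be the least positive integer $k\le p^2$ such that $|\lambda^{k}-1|_p\le p^{-1}$ for each eigenvalue $\lambda$ of $A$. Let $\widetilde{\mathrm{SL}}_2(\mathbb Z_p)$ be the set of those $A$ for which moreover $\log(\lambda^{\kappa(A)})\ne0$ for each eigenvalue $\lambda$ of $A$, where $\log x=\sum_{n\ge1}(-1)^{n-1}(x-1)^n/n$ is the $p$-adic logarithm. Finally, let $Vp(n,w)=\{A_{w_m}: m\ge0,\ w_n\text{ is a prefix of }\mathrm T^mw\}$, viewed as a set of matrices over $\mathbb Z_p$, and $Vp(w)=\bigcap_{n\ge1}\overline{Vp(n,w)}$ (closures in the $p$-adic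 topology). Claim: if $A_1,A_2\in\widetilde{\mathrm{SL}}_2(\mathbb Z_p)$ are such that the two eigenvectors of $A_1$ and the two eigenvectors of $A_2$ in $\mathbf P^1_{\overline{\mathbb Q}_p}$ are all distinct, and if $A_1,A_2\in Vp(w)$, then $(w,\mathbf x_p)\notin\mathbf{LMad}$ for every $\mathbf x_p\in\mathbf P^1_{\mathbb Q_p}$. -/

import Mathlib

namespace PLC

noncomputable section

/-- Infinite words over the positive integers; `w i` is the letter with (zero-based) index `i`. -/
abbrev Word : Type := ℕ → ℕ+

/-- The words over the alphabet `{1, …, N}`. -/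
def words (N : ℕ) : Set Word := {w | ∀ i, (w i : ℕ) ≤ N}

/-- The matrix `A_a = (0 1; 1 a)` of a letter. -/
def letterMatrix (a : ℕ+) : Matrix (Fin 2) (Fin 2) ℤ := !![0, 1; 1, (a : ℤ)]

/-- The matrix `A_{a₁} ⋯ A_{a_n}` of a finite word `a₁ … a_n`. -/
def wordMatrix (u : List ℕ+) : Matrix (Fin 2) (Fin 2) ℤ := (u.map letterMatrix).prod

/-- The prefix of length `n` of an infinite word. -/
def wordPrefix (w : Word) (n : ℕ) : List ℕ+ := (List.range n).map w

/-- The left shift on infinite words. -/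
def shift (w : Word) : Word := fun i => w (i + 1)

variable (p : ℕ) [Fact p.Prime]

/-- The projective line over the `p`-adic numbers. -/
abbrev ProjLine : Type := Projectivization ℚ_[p] (Fin 2 → ℚ_[p])

/-- The linear map of `ℚ_p²` given by the matrix `A_a`. -/
def letterMap (a : ℕ+) : (Fin 2 → ℚ_[p]) →ₗ[ℚ_[p]] (Fin 2 → ℚ_[p]) :=
  Matrix.toLin' ((letterMatrix a).map (Int.cast : ℤ → ℚ_[p]))

theorem letterMap_injective (a : ℕ+) : Function.Injective (letterMap p a) := by
  intro u v h
  have h0 := congrFun h 0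
  have h1 := congrFun h 1
  simp [letterMap, letterMatrix, Matrix.mulVec, dotProduct, Fin.sum_univ_two] at h0 h1
  rw [h0] at h1
  have h2 : u 0 = v 0 := add_right_cancel h1
  funext i
  fin_cases i
  · exact h2
  · exact h0

/-- The extended shift `T (w, q) = (T w, A_{a₁} q)`, where `a₁` is the first letter of `w`. -/
def extShift (x : Word × ProjLine p) : Word × ProjLine p :=
  (shift x.1, Projectivization.map (letterMap p (x.1 0)) (letterMap_injective p (x.1 0)) x.2)

/-- The points `(q₁ : q₂)` such that, for all integers `(a, b) ≠ (0, 0)`,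
`|a q₁ + b q₂|_p · min {|q₁|_p⁻¹, |q₂|_p⁻¹} ≥ min {|a|⁻², |b|⁻²} · ε`, with `0⁻¹ = ∞` inside
the minima.  The inequality is written with its denominators cleared; it is homogeneous
in `(q₁, q₂)` (see `mk_mem_PBadEps_iff`). -/
def PBadEps (ε : ℝ) : Set (ProjLine p) :=
  {q | ∀ a b : ℤ, (a, b) ≠ (0, 0) →
    ε * max ‖q.rep 0‖ ‖q.rep 1‖ ≤
      ‖(a : ℚ_[p]) * q.rep 0 + (b : ℚ_[p]) * q.rep 1‖ * max |(a : ℝ)| |(b : ℝ)| ^ 2}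

/-- Membership in `PBadEps` may be tested on any representative. -/
theorem mk_mem_PBadEps_iff (ε : ℝ) (v : Fin 2 → ℚ_[p]) (hv : v ≠ 0) :
    Projectivization.mk ℚ_[p] v hv ∈ PBadEps p ε ↔
      ∀ a b : ℤ, (a, b) ≠ (0, 0) →
        ε * max ‖v 0‖ ‖v 1‖ ≤
          ‖(a : ℚ_[p]) * v 0 + (b : ℚ_[p]) * v 1‖ * max |(a : ℝ)| |(b : ℝ)| ^ 2 := by
  obtain ⟨c, hc⟩ := Projectivization.exists_smul_eq_mk_rep ℚ_[p] v hv
  have hpos : 0 < ‖(c : ℚ_[p])‖ := norm_pos_iff.mpr c.ne_zero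
  unfold PBadEps
  rw [Set.mem_ofPred_eq, ← hc]
  refine forall_congr' fun a => forall_congr' fun b => imp_congr_right fun _ => ?_
  have e0 : (c • v) 0 = (c : ℚ_[p]) * v 0 := rfl
  have e1 : (c • v) 1 = (c : ℚ_[p]) * v 1 := rfl
  have e2 : (a : ℚ_[p]) * (c * v 0) + (b : ℚ_[p]) * (c * v 1) =
      c * ((a : ℚ_[p]) * v 0 + (b : ℚ_[p]) * v 1) := by ring
  rw [e0, e1, e2, norm_mul, norm_mul, norm_mul, ← mul_max_of_nonneg _ _ hpos.le,
    mul_left_comm, mul_assoc, mul_le_mul_iff_right₀ hpos]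

/-- The set `LMad_ε`: all pairs whose iterates `T^n (w, x_p)`, `n = 1, 2, …`, have their word over
the alphabet `{1, …, N}`, `N = [ε⁻¹] + 1`, and their point in `PBad_ε`. -/
def LMadEps (ε : ℝ) : Set (Word × ProjLine p) :=
  {x | ∀ n : ℕ, 1 ≤ n →
    ((extShift p)^[n] x).1 ∈ words (⌊ε⁻¹⌋₊ + 1) ∧ ((extShift p)^[n] x).2 ∈ PBadEps p ε}

/-- The set `LMad`: the union of the sets `LMad_ε` over `ε > 0`. -/
def LMad : Set (Word × ProjLine p) := {x | ∃ ε : ℝ, 0 < ε ∧ x ∈ LMadEps p ε}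

/-- The `2 × 2` matrices over `ℤ_p` with determinant `1` or `-1`. -/
def SLpm : Set (Matrix (Fin 2) (Fin 2) ℤ_[p]) := {A | A.det = 1 ∨ A.det = -1}

/-- The embedding of `ℤ_p` into the algebraic closure of `ℚ_p`. -/
def toAlgCl : ℤ_[p] →+* PadicAlgCl p :=
  (algebraMap ℚ_[p] (PadicAlgCl p)).comp PadicInt.Coe.ringHom

variable {p}

/-- A matrix over `ℤ_p` as an endomorphism of the plane over the algebraic closure of `ℚ_p`. -/
def endAlgCl (A : Matrix (Fin 2) (Fin 2) ℤ_[p]) :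
    Module.End (PadicAlgCl p) (Fin 2 → PadicAlgCl p) :=
  Matrix.toLin' (A.map (toAlgCl p))

/-- The eigenvectors of `A`, as points of the projective line over the algebraic closure
of `ℚ_p`. -/
def eigenpoints (A : Matrix (Fin 2) (Fin 2) ℤ_[p]) :
    Set (Projectivization (PadicAlgCl p) (Fin 2 → PadicAlgCl p)) :=
  {v | ∃ l : PadicAlgCl p, (endAlgCl A).HasEigenvector l v.rep}

variable (p) in
/-- The matrices in `SL₂^±(ℤ_p)` with two different eigenvectors in the projective line over the
algebraic closure of `ℚ_p`. -/
def SLpmOne : Set (Matrix (Fin 2) (Fin 2) ℤ_[p]) :=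
  {A | A ∈ SLpm p ∧ (eigenpoints A).Nontrivial}

/-- The `p`-adic logarithm `∑_{n ≥ 1} (-1)^(n-1) (x - 1)^n / n`, meaningful for `|x - 1|_p < 1`. -/
def padicLog (x : PadicAlgCl p) : PadicAlgCl p :=
  ∑' n : ℕ, (-1) ^ n * (x - 1) ^ (n + 1) / ((n : PadicAlgCl p) + 1)

/-- `κ(A)`: the least positive integer `k ≤ p²` with `|λ^k - 1|_p ≤ p⁻¹` for every
eigenvalue `λ` of `A`. -/
def kappa (A : Matrix (Fin 2) (Fin 2) ℤ_[p]) : ℕ :=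
  sInf {k : ℕ | 0 < k ∧ k ≤ p ^ 2 ∧
    ∀ l : PadicAlgCl p, (endAlgCl A).HasEigenvalue l → ‖l ^ k - 1‖ ≤ (p : ℝ)⁻¹}

variable (p) in
/-- The matrices `A` with two different eigenvectors such that `log (λ^κ(A)) ≠ 0` for
every eigenvalue `λ` of `A`. -/
def SLtilde : Set (Matrix (Fin 2) (Fin 2) ℤ_[p]) :=
  {A | A ∈ SLpmOne p ∧
    ∀ l : PadicAlgCl p, (endAlgCl A).HasEigenvalue l → padicLog (l ^ kappa A) ≠ 0}

variable (p) in
/-- `Vp(n, w)`: the matrices `A_{w_m}`, viewed over `ℤ_p`, of those prefixes `w_m` (`m ≥ 0`) of `w`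
for which the prefix `w_n` of `w` is also a prefix of `T^m w`. -/
def Vpn (n : ℕ) (w : Word) : Set (Matrix (Fin 2) (Fin 2) ℤ_[p]) :=
  {A | ∃ m : ℕ, wordPrefix (shift^[m] w) n = wordPrefix w n ∧
    A = (wordMatrix (wordPrefix w m)).map (Int.cast : ℤ → ℤ_[p])}

variable (p) in
/-- `Vp(w)`: the intersection over `n ≥ 1` of the `p`-adic closures of the sets `Vp(n, w)`. -/
def Vp (w : Word) : Set (Matrix (Fin 2) (Fin 2) ℤ_[p]) :=
  ⋂ (n : ℕ) (_ : 1 ≤ n), closure (Vpn p n w)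

end

end PLC

/-!
Suppose that all `T^n (w, x_p)`, `n ≥ 1`, lie in `PBad_ε`, and let the row vector `v` span `x_p`.
As the `A_a` are symmetric, `T^n` acts on `x_p` by right multiplication of `v` by `A_{w_n}`, so the
set `C` of all such `v` is closed and stable under `v ↦ v A` for each `A ∈ Vp(w)`, while it contains
no nonzero multiple of a rational vector.

If `v A` is not a multiple of `v` and no power of `A` is scalar, then the orbit `v A^k` accumulates
on too many lines. Some power of `A` is `1 + p² F`, and, computing in `ℤ_p[F]`, which has rank two,
`(1 + p² F)^k = c_k (1 + p² t_k F)` with units `c_k`. The sequence `t_k` satisfies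
`|t_k - t_m| = |k - m|`, so it is dense in `ℤ_p` and `C` contains the arc `v + p² t v F`,
`t ∈ ℤ_p`. This arc, being a `p`-adic neighbourhood in the projective line, passes through a
rational point, which is impossible. Hence `v` is a left eigenvector of both `A₁` and `A₂`, and
`(-v₁, v₀)` spans a common right eigenvector.

The logarithm enters only through the fact that no power of `A` is scalar: otherwise the
eigenvalues are roots of unity, as `det A = ±1`, and their logarithms vanish.
-/

namespace PLC

variable {p : ℕ} [Fact p.Prime]

theorem one_le_mul_norm_natCast {n : ℕ} (hn : n ≠ 0) : 1 ≤ n * ‖(n : ℚ_[p])‖ := by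
  have hn' : (n : ℚ_[p]) ≠ 0 := Nat.cast_ne_zero.mpr hn
  have hp : 0 < (p : ℝ) := mod_cast (Fact.out : p.Prime).pos
  rw [Padic.norm_eq_zpow_neg_valuation hn', Padic.valuation_natCast, zpow_neg, zpow_natCast,
    ← div_eq_mul_inv, one_le_div (pow_pos hp _)]
  exact_mod_cast Nat.le_of_dvd (Nat.pos_of_ne_zero hn) pow_padicValNat_dvd

theorem norm_choose_succ_le (n k : ℕ) :
    ‖(n.choose (k + 1) : ℚ_[p])‖ ≤ (k + 1) * ‖(n : ℚ_[p])‖ := by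
  cases n with
  | zero => simp
  | succ n =>
    have hmul : ‖((n + 1).choose (k + 1) : ℚ_[p])‖ * ‖((k + 1 : ℕ) : ℚ_[p])‖ ≤
        ‖((n + 1 : ℕ) : ℚ_[p])‖ := by
      rw [← norm_mul, ← Nat.cast_mul, ← Nat.add_one_mul_choose_eq, Nat.cast_mul, norm_mul]
      exact mul_le_of_le_one_right (norm_nonneg _) (IsUltrametricDist.norm_natCast_le_one _ _)
    calc ‖((n + 1).choose (k + 1) : ℚ_[p])‖
        ≤ ‖((n + 1).choose (k + 1) : ℚ_[p])‖ * ((k + 1 : ℕ) * ‖((k + 1 : ℕ) : ℚ_[p])‖) :=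
          le_mul_of_one_le_right (norm_nonneg _) (one_le_mul_norm_natCast k.succ_ne_zero)
      _ = (k + 1) * (‖((n + 1).choose (k + 1) : ℚ_[p])‖ * ‖((k + 1 : ℕ) : ℚ_[p])‖) := by
          push_cast; ring
      _ ≤ _ := by gcongr

theorem norm_choose_sub_neg_one_pow_le (n j : ℕ) :
    ‖(n.choose j : ℚ_[p]) - (-1) ^ j‖ ≤ (j + 1) * ‖((n + 1 : ℕ) : ℚ_[p])‖ := by
  induction j with
  | zero => simp
  | succ j ih =>
    have hpascal : (n.choose (j + 1) : ℚ_[p]) - (-1) ^ (j + 1) =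
        (n + 1).choose (j + 1) - ((n.choose j : ℚ_[p]) - (-1) ^ j) := by
      rw [Nat.choose_succ_succ]; push_cast; ring
    rw [hpascal, sub_eq_add_neg]
    refine (IsUltrametricDist.norm_add_le_max _ _).trans (max_le ?_ ?_)
    · refine (norm_choose_succ_le _ _).trans ?_
      gcongr
      simp
    · rw [norm_neg]
      refine ih.trans ?_
      gcongr
      simp

theorem sum_choose_mul_pow_succ_div {K : Type*} [Field K] [CharZero K] (n : ℕ) (y : K) :
    ∑ j ∈ Finset.range (n + 1), (n.choose j : K) * (y ^ (j + 1) / (j + 1)) =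
      ((1 + y) ^ (n + 1) - 1) / (n + 1) := by
  have hn : (n : K) + 1 ≠ 0 := n.cast_add_one_ne_zero
  rw [add_comm 1 y, add_pow, eq_div_iff hn, Finset.sum_mul, Finset.sum_range_succ' _ (n + 1)]
  simp only [one_pow, mul_one, pow_zero, Nat.choose_zero_right, Nat.cast_one, add_sub_cancel_right]
  refine Finset.sum_congr rfl fun j _ => ?_
  have hj : (j : K) + 1 ≠ 0 := j.cast_add_one_ne_zero
  have h := congrArg (Nat.cast : ℕ → K) (Nat.add_one_mul_choose_eq n j)
  push_cast at h
  field_simp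
  linear_combination y ^ (j + 1) * h

section Logarithm

open Filter Topology

variable (p) {K : Type*} [NormedField K]

theorem norm_pow_succ_div_le [NormedAlgebra ℚ_[p] K] (y : K) (j : ℕ) :
    ‖y ^ (j + 1) / ((j : K) + 1)‖ ≤ (j + 1) * ‖y‖ ^ (j + 1) := by
  have h : 1 ≤ ((j : ℝ) + 1) * ‖(j : K) + 1‖ := by
    simpa [← norm_algebraMap' K] using one_le_mul_norm_natCast (p := p) j.succ_ne_zero
  rw [norm_div, norm_pow]
  refine div_le_of_le_mul₀ (norm_nonneg _) (by positivity) ?_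
  rw [mul_right_comm]
  exact le_mul_of_one_le_left (by positivity) h

/- The coefficients of `((1 + y) ^ (n + 1) - 1) / (n + 1)` are `n.choose j / (j + 1)`, and
`n.choose j ≡ (-1) ^ j` modulo `n + 1` up to a denominator of size at most `j + 1`. -/
theorem norm_sum_log_sub_le [NormedAlgebra ℚ_[p] K] {y : K} {C : ℝ}
    (hC : ∀ j : ℕ, ((j : ℝ) + 1) ^ 2 * ‖y‖ ^ (j + 1) ≤ C) (n : ℕ) :
    ‖∑ j ∈ Finset.range (n + 1), (-1) ^ j * y ^ (j + 1) / ((j : K) + 1) -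
      ((1 + y) ^ (n + 1) - 1) / (n + 1)‖ ≤ C * ‖((n + 1 : ℕ) : ℚ_[p])‖ := by
  have : CharZero K := charZero_of_injective_algebraMap (algebraMap ℚ_[p] K).injective
  have : IsUltrametricDist K := .of_normedAlgebra ℚ_[p]
  have hC0 : 0 ≤ C := le_trans (by positivity) (hC 0)
  rw [← sum_choose_mul_pow_succ_div, ← Finset.sum_sub_distrib]
  refine IsUltrametricDist.norm_sum_le_of_forall_le_of_nonneg (by positivity) fun j _ => ?_
  have hcoeff : ‖(-1) ^ j - (n.choose j : K)‖ ≤ (j + 1) * ‖((n + 1 : ℕ) : ℚ_[p])‖ := by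
    rw [norm_sub_rev]
    simpa [← norm_algebraMap' K] using norm_choose_sub_neg_one_pow_le (p := p) n j
  calc _ = ‖(-1) ^ j - (n.choose j : K)‖ * ‖y ^ (j + 1) / ((j : K) + 1)‖ := by
        rw [← norm_mul]; congr 1; ring
    _ ≤ ((j + 1) * ‖((n + 1 : ℕ) : ℚ_[p])‖) * ((j + 1) * ‖y‖ ^ (j + 1)) := by
        gcongr
        exact norm_pow_succ_div_le p y j
    _ = ((j : ℝ) + 1) ^ 2 * ‖y‖ ^ (j + 1) * ‖((n + 1 : ℕ) : ℚ_[p])‖ := by ring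
    _ ≤ _ := by gcongr; exact hC j

theorem tendsto_log_term_zero [NormedAlgebra ℚ_[p] K] {y : K} (hy : ‖y‖ < 1) :
    Tendsto (fun j : ℕ => (-1) ^ j * y ^ (j + 1) / ((j : K) + 1)) atTop (𝓝 0) := by
  have hlim : Tendsto (fun j : ℕ => ((j + 1 : ℕ) : ℝ) * ‖y‖ ^ (j + 1)) atTop (𝓝 0) :=
    (tendsto_self_mul_const_pow_of_abs_lt_one (by rwa [abs_norm])).comp (tendsto_add_atTop_nat 1)
  refine squeeze_zero_norm (fun j => ?_) hlim
  rw [mul_div_assoc, norm_mul, norm_pow, norm_neg, norm_one, one_pow, one_mul]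
  exact_mod_cast norm_pow_succ_div_le p y j

theorem hasSum_log_zero_of_pow_eq_one [NormedAlgebra ℚ_[p] K] {y : K} (hy : ‖y‖ < 1) {n : ℕ}
    (hn : n ≠ 0) (h : (1 + y) ^ n = 1) :
    HasSum (fun j : ℕ => (-1) ^ j * y ^ (j + 1) / ((j : K) + 1)) 0 := by
  have : IsUltrametricDist K := .of_normedAlgebra ℚ_[p]
  have hcauchy := NonarchimedeanAddGroup.cauchySeq_sum_of_tendsto_cofinite_zero
    ((tendsto_log_term_zero p hy).mono_left Nat.cofinite_eq_atTop.le)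
  obtain ⟨C, hC⟩ : ∃ C : ℝ, ∀ j : ℕ, ((j : ℝ) + 1) ^ 2 * ‖y‖ ^ (j + 1) ≤ C := by
    obtain ⟨C, hC⟩ := (tendsto_pow_const_mul_const_pow_of_abs_lt_one 2
      (r := ‖y‖) (by rwa [abs_norm])).bddAbove_range
    exact ⟨C, fun j => by exact_mod_cast hC ⟨j + 1, rfl⟩⟩
  -- The series converges, so it suffices that its partial sums of length `n * p ^ k` tend to `0`.
  have hp : 1 < p := (Fact.out : p.Prime).one_lt
  have hindex : Tendsto (fun k : ℕ => n * p ^ k) atTop atTop :=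
    (tendsto_pow_atTop_atTop_of_one_lt hp).const_mul_atTop' (Nat.pos_of_ne_zero hn)
  refine tendsto_nhds_of_cauchySeq_of_subseq hcauchy (tendsto_finset_range.comp hindex) ?_
  have hlim : Tendsto (fun k : ℕ => C * ((p : ℝ)⁻¹) ^ k) atTop (𝓝 (C * 0)) :=
    (tendsto_pow_atTop_nhds_zero_of_lt_one (by positivity)
      (inv_lt_one_of_one_lt₀ (mod_cast hp))).const_mul C
  rw [mul_zero] at hlim
  refine squeeze_zero_norm (fun k => ?_) hlim
  obtain ⟨m, hm⟩ := Nat.exists_eq_succ_of_ne_zero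
    (mul_ne_zero hn (pow_ne_zero k (Fact.out : p.Prime).ne_zero))
  have hpow : (1 + y) ^ (m + 1) = 1 := by rw [← Nat.succ_eq_add_one, ← hm, pow_mul, h, one_pow]
  have hC0 : 0 ≤ C := le_trans (by positivity) (hC 0)
  have hbound := norm_sum_log_sub_le p hC m
  rw [hpow, sub_self, zero_div, sub_zero, ← Nat.succ_eq_add_one, ← hm] at hbound
  refine hbound.trans (mul_le_mul_of_nonneg_left ?_ hC0)
  rw [Nat.cast_mul, Nat.cast_pow, norm_mul, norm_pow, Padic.norm_p]
  exact mul_le_of_le_one_left (by positivity) (IsUltrametricDist.norm_natCast_le_one _ _)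

end Logarithm

theorem padicLog_eq_zero_of_pow_eq_one {x : PadicAlgCl p} (hx : ‖x - 1‖ < 1) {n : ℕ}
    (hn : n ≠ 0) (h : x ^ n = 1) : padicLog x = 0 :=
  (hasSum_log_zero_of_pow_eq_one p hx hn (by rwa [add_sub_cancel])).tsum_eq

theorem norm_pow_kappa_sub_one_le (A : Matrix (Fin 2) (Fin 2) ℤ_[p]) {l : PadicAlgCl p}
    (hl : (endAlgCl A).HasEigenvalue l) : ‖l ^ kappa A - 1‖ ≤ (p : ℝ)⁻¹ := by
  -- If no `k` is admissible, then `kappa A = sInf ∅ = 0` and the bound is trivial.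
  rcases Set.eq_empty_or_nonempty {k : ℕ | 0 < k ∧ k ≤ p ^ 2 ∧
    ∀ l : PadicAlgCl p, (endAlgCl A).HasEigenvalue l → ‖l ^ k - 1‖ ≤ (p : ℝ)⁻¹} with h | h
  · rw [kappa, h, Nat.sInf_empty, pow_zero, sub_self, norm_zero]
    positivity
  · exact (Nat.sInf_mem h).2.2 l hl

theorem pow_eq_of_pow_eq_scalar {A : Matrix (Fin 2) (Fin 2) ℤ_[p]} {n : ℕ} {c : ℤ_[p]}
    (h : A ^ n = Matrix.scalar (Fin 2) c) {l : PadicAlgCl p} (hl : (endAlgCl A).HasEigenvalue l) :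
    l ^ n = toAlgCl p c := by
  obtain ⟨v, hv⟩ := hl.exists_hasEigenvector
  have hpow : endAlgCl A ^ n = toAlgCl p c • 1 := by
    have hmap := congrArg (toAlgCl p).mapMatrix h
    rw [map_pow] at hmap
    rw [endAlgCl, ← Matrix.toLin'_pow, ← RingHom.mapMatrix_apply, hmap]
    ext i j
    simp [Pi.single_apply]
  have hvn := hv.pow_apply n
  rw [hpow] at hvn
  exact (smul_left_injective _ hv.2 hvn).symm

theorem pow_four_eq_one_of_pow_eq_scalar {A : Matrix (Fin 2) (Fin 2) ℤ_[p]} (hA : A ∈ SLpm p)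
    {n : ℕ} {c : ℤ_[p]} (h : A ^ n = Matrix.scalar (Fin 2) c) : c ^ 4 = 1 := by
  have hdet : A.det ^ n = c ^ 2 := by simpa using congrArg Matrix.det h
  have hsq : A.det ^ 2 = 1 := sq_eq_one_iff.mpr hA
  calc c ^ 4 = (A.det ^ 2) ^ n := by rw [pow_right_comm, hdet]; ring
    _ = 1 := by rw [hsq, one_pow]

theorem pow_notMem_range_scalar_of_mem_SLtilde {A : Matrix (Fin 2) (Fin 2) ℤ_[p]}
    (hA : A ∈ SLtilde p) {n : ℕ} (hn : n ≠ 0) : A ^ n ∉ Set.range (Matrix.scalar (Fin 2)) := by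
  rintro ⟨c, hc⟩
  obtain ⟨P, l, hP⟩ := hA.1.2.nonempty
  have hl := Module.End.hasEigenvalue_of_hasEigenvector hP
  refine hA.2 l hl (padicLog_eq_zero_of_pow_eq_one ?_ (mul_ne_zero hn four_ne_zero) ?_)
  · exact (norm_pow_kappa_sub_one_le A hl).trans_lt
      (inv_lt_one_of_one_lt₀ (mod_cast (Fact.out : p.Prime).one_lt))
  · rw [pow_right_comm, pow_mul, pow_eq_of_pow_eq_scalar hc.symm hl, ← map_pow,
      pow_four_eq_one_of_pow_eq_scalar hA.1.1 hc.symm, map_one, one_pow]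

theorem natCast_dvd_pow_of_le {n k : ℕ} (hn : n ≠ 0) (h : n ≤ p ^ k) :
    (n : ℤ_[p]) ∣ (p : ℤ_[p]) ^ k := by
  have hp : p.Prime := Fact.out
  obtain ⟨e, u, hu, rfl⟩ := Nat.exists_eq_pow_mul_and_not_dvd hn p hp.ne_one
  have hunit : IsUnit (u : ℤ_[p]) :=
    PadicInt.isUnit_iff.mpr (PadicInt.norm_natCast_eq_one_iff.mpr
      ((Nat.Prime.coprime_iff_not_dvd hp).mpr hu))
  have hu0 : 0 < u := Nat.pos_of_ne_zero (right_ne_zero_of_mul hn)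
  rw [Nat.cast_mul, Nat.cast_pow, hunit.mul_right_dvd]
  exact pow_dvd_pow _ ((Nat.pow_le_pow_iff_right hp.one_lt).mp
    ((Nat.le_mul_of_pos_right _ hu0).trans h))

theorem natCast_mul_pow_three_dvd_choose_mul (m j : ℕ) :
    (m * p ^ 3 : ℤ_[p]) ∣ m.choose (j + 2) * ((p : ℤ_[p]) ^ 2) ^ (j + 2) := by
  cases m with
  | zero => simp
  | succ m =>
    have hle : j + 2 ≤ p ^ (2 * j + 1) := by
      have := Nat.lt_pow_self (n := 2 * j + 1) (Fact.out : p.Prime).one_lt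
      omega
    obtain ⟨q, hq⟩ := natCast_dvd_pow_of_le (p := p) (by omega) hle
    refine ⟨m.choose (j + 1) * q, ?_⟩
    have hchoose := congrArg (Nat.cast : ℕ → ℤ_[p]) (Nat.add_one_mul_choose_eq m (j + 1))
    push_cast at hq hchoose ⊢
    linear_combination ((m + 1).choose (j + 2) : ℤ_[p]) * (p : ℤ_[p]) ^ 3 * hq -
      (p : ℤ_[p]) ^ 3 * q * hchoose

theorem exists_one_add_smul_pow_eq {B : Type*} [Ring B] [Algebra ℤ_[p] B] (x : B) (m : ℕ) :
    ∃ y : B, (1 + (p ^ 2 : ℤ_[p]) • x) ^ m =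
      1 + (m * p ^ 2 : ℤ_[p]) • (x + (p : ℤ_[p]) • y) := by
  cases m with
  | zero => exact ⟨0, by simp⟩
  | succ m =>
    choose q hq using natCast_mul_pow_three_dvd_choose_mul (p := p) (m + 1)
    refine ⟨∑ j ∈ Finset.range m, q j • x ^ (j + 2), ?_⟩
    have hterm (i : ℕ) : ((p ^ 2 : ℤ_[p]) • x) ^ i * (m + 1).choose i =
        ((m + 1).choose i * ((p : ℤ_[p]) ^ 2) ^ i) • x ^ i := by
      rw [smul_pow, smul_mul_assoc, ← Nat.cast_comm, ← nsmul_eq_mul, ← Nat.cast_smul_eq_nsmul ℤ_[p],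
        smul_smul, mul_comm]
    have hcoeff (j : ℕ) : ((m + 1 : ℕ) * p ^ 3 * q j : ℤ_[p]) =
        (m + 1 : ℕ) * p ^ 2 * (p * q j) := by ring
    rw [add_comm 1, (Commute.one_right _).add_pow]
    simp only [one_pow, mul_one, hterm]
    rw [Finset.sum_range_succ', Finset.sum_range_succ']
    simp only [hq, zero_add, pow_zero, pow_one, Nat.choose_zero_right, Nat.choose_one_right,
      Nat.cast_one, mul_one, one_smul, smul_add, smul_smul, Finset.smul_sum, hcoeff]
    abel

theorem isUnit_one_add_prime_mul (x : ℤ_[p]) : IsUnit (1 + p * x) := by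
  by_contra h
  have h1 : (p : ℤ_[p]) ∣ 1 + p * x := by
    rw [← PadicInt.norm_lt_one_iff_dvd]
    exact PadicInt.mem_nonunits.mp h
  have h2 : (p : ℤ_[p]) ∣ 1 := (dvd_add_left (dvd_mul_right _ _)).mp h1
  exact PadicInt.prime_p.not_isUnit (isUnit_of_dvd_one h2)

section QuadraticAlgebra

open QuadraticAlgebra

/- Divided by `(z * w).re * z.re`, this identity gives the difference of the slopes `im / re` of
`z * w` and of `z`. -/
theorem mul_im_mul_re_sub {R : Type*} [CommRing R] {a b : R} (z w : QuadraticAlgebra R a b) :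
    (z * w).im * z.re - z.im * (z * w).re = z.norm * w.im := by
  simp only [re_mul, im_mul, norm_def]
  ring

variable (a b : ℤ_[p])

theorem exists_one_add_smul_omega_pow_eq (k : ℕ) :
    ∃ c d : ℤ_[p], (1 + (p ^ 2 : ℤ_[p]) • (ω : QuadraticAlgebra ℤ_[p] a b)) ^ k =
      ⟨1 + p * c, k * p ^ 2 * (1 + p * d)⟩ := by
  obtain ⟨y, hy⟩ := exists_one_add_smul_pow_eq (p := p) (ω : QuadraticAlgebra ℤ_[p] a b) k
  refine ⟨k * p ^ 2 * y.re, y.im, hy.trans ?_⟩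
  ext
  · simp only [smul_add, re_add, re_one, re_smul, omega_re, smul_eq_mul, mul_zero, zero_add]
    ring
  · simp [mul_add]

theorem isUnit_norm_one_add_smul_omega :
    IsUnit (1 + (p ^ 2 : ℤ_[p]) • (ω : QuadraticAlgebra ℤ_[p] a b)).norm := by
  convert isUnit_one_add_prime_mul (p := p) (p * b - p ^ 3 * a) using 1
  simp only [norm_def, re_add, re_one, re_smul, omega_re, smul_eq_mul, mul_zero, add_zero, mul_one,
    im_add, im_one, im_smul, omega_im, zero_add]
  ring

theorem exists_one_add_smul_omega_pow_eq_smul :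
    ∃ t : ℕ → ℤ_[p], (∀ k m, ‖t (k + m) - t k‖ = ‖(m : ℤ_[p])‖) ∧
      ∀ k, ∃ c : ℤ_[p]ˣ, (1 + (p ^ 2 : ℤ_[p]) • (ω : QuadraticAlgebra ℤ_[p] a b)) ^ k =
        (c : ℤ_[p]) • (1 + (t k * p ^ 2) • ω) := by
  set z := 1 + (p ^ 2 : ℤ_[p]) • (ω : QuadraticAlgebra ℤ_[p] a b) with hz
  choose c d hcd using exists_one_add_smul_omega_pow_eq a b
  rw [← hz] at hcd
  choose u hu using fun k => isUnit_one_add_prime_mul (c k)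
  have hre k : (z ^ k).re = u k := by rw [hcd, hu]
  have him k : (z ^ k).im = k * p ^ 2 * (1 + p * d k) := by rw [hcd]
  have hsub k m : ((k + m : ℕ) * (1 + p * d (k + m)) * u k -
      k * (1 + p * d k) * u (k + m)) = (z.norm) ^ k * (m * (1 + p * d m)) := by
    have hp : (p : ℤ_[p]) ≠ 0 := Nat.cast_ne_zero.mpr (Fact.out : p.Prime).ne_zero
    have h := mul_im_mul_re_sub (z ^ k) (z ^ m)
    rw [← pow_add, map_pow, him, him, him, hre, hre] at h
    refine mul_left_cancel₀ (pow_ne_zero 2 hp) ?_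
    linear_combination h
  refine ⟨fun k => k * (1 + p * d k) * (u k)⁻¹, fun k m => ?_, fun k => ⟨u k, ?_⟩⟩
  · have hunit : ‖z.norm ^ k * (1 + p * d m)‖ = 1 := PadicInt.isUnit_iff.mp <|
      ((isUnit_norm_one_add_smul_omega a b).pow k).mul (isUnit_one_add_prime_mul (d m))
    calc _ = ‖((k + m : ℕ) * (1 + p * d (k + m)) * ↑(u (k + m))⁻¹ -
            k * (1 + p * d k) * ↑(u k)⁻¹ : ℤ_[p])‖ * ‖(u k * u (k + m) : ℤ_[p])‖ := by simp
      _ = ‖(m : ℤ_[p]) * (z.norm ^ k * (1 + p * d m))‖ := by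
        rw [← norm_mul, mul_left_comm (m : ℤ_[p]), ← hsub]
        congr 1
        linear_combination ((k + m : ℕ) * (1 + p * d (k + m)) * u k : ℤ_[p]) *
          (u (k + m)).inv_mul - (k * (1 + p * d k) * u (k + m) : ℤ_[p]) * (u k).inv_mul
      _ = ‖(m : ℤ_[p])‖ := by rw [norm_mul, hunit, mul_one]
  · ext
    · simp [hre]
    · simp only [him, smul_add, im_add, im_smul, im_one, smul_eq_mul, mul_zero, omega_im, mul_one,
        zero_add]
      linear_combination (-k * (1 + p * d k) * p ^ 2 : ℤ_[p]) * (u k).inv_mul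

end QuadraticAlgebra

theorem denseRange_of_norm_sub_eq {t : ℕ → ℤ_[p]}
    (ht : ∀ k m, ‖t (k + m) - t k‖ = ‖(m : ℤ_[p])‖) : DenseRange t := by
  have toZModPow_eq_iff (n : ℕ) (x y : ℤ_[p]) :
      PadicInt.toZModPow n x = PadicInt.toZModPow n y ↔ ‖x - y‖ ≤ (p : ℝ) ^ (-n : ℤ) := by
    rw [← sub_eq_zero, ← map_sub, ← RingHom.mem_ker, PadicInt.ker_toZModPow,
      PadicInt.norm_le_pow_iff_mem_span_pow]
  have hsurj (n : ℕ) :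
      Function.Surjective fun a : ZMod (p ^ n) => PadicInt.toZModPow n (t a.val) := by
    have : NeZero (p ^ n) := ⟨pow_ne_zero n (Fact.out : p.Prime).ne_zero⟩
    refine Finite.injective_iff_surjective.mp fun a b hab => ?_
    wlog hle : b.val ≤ a.val generalizing a b
    · exact (this b a hab.symm (le_of_not_ge hle)).symm
    obtain ⟨m, hm⟩ := Nat.exists_eq_add_of_le hle
    have hdvd : p ^ n ∣ m := by
      have hnorm := (toZModPow_eq_iff n _ _).mp hab
      rw [hm, ht, ← Int.cast_natCast, PadicInt.norm_int_le_pow_iff_dvd] at hnorm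
      exact_mod_cast hnorm
    have hm0 : m = 0 := Nat.eq_zero_of_dvd_of_lt hdvd (by have := a.val_lt; omega)
    exact ZMod.val_injective _ (by omega)
  rw [Metric.denseRange_iff]
  intro x r hr
  obtain ⟨n, hn⟩ := PadicInt.exists_pow_neg_lt p hr
  obtain ⟨a, ha⟩ := hsurj n (PadicInt.toZModPow n x)
  exact ⟨a.val, ((toZModPow_eq_iff n x _).mp ha.symm).trans_lt hn⟩

theorem add_smul_mem_of_one_add_smul_pow_mem {B M : Type*} [Ring B] [Algebra ℤ_[p] B]
    [AddCommGroup M] [Module ℤ_[p] M] [TopologicalSpace M] [ContinuousAdd M]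
    [ContinuousSMul ℤ_[p] M] {C : Set M} (hC : IsClosed C)
    (hsmul : ∀ c : ℤ_[p], ∀ m ∈ C, c • m ∈ C) {x : B} {a b : ℤ_[p]}
    (hx : x * x = a • 1 + b • x) (L : B →ₗ[ℤ_[p]] M)
    (hpow : ∀ k : ℕ, L ((1 + (p ^ 2 : ℤ_[p]) • x) ^ k) ∈ C) (t : ℤ_[p]) :
    L 1 + (t * p ^ 2) • L x ∈ C := by
  obtain ⟨s, hs, hpow_eq⟩ := exists_one_add_smul_omega_pow_eq_smul a b
  refine (denseRange_of_norm_sub_eq hs).induction_on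
    (p := fun s => L 1 + (s * p ^ 2 : ℤ_[p]) • L x ∈ C) t
    (hC.preimage (by fun_prop)) fun k => ?_
  obtain ⟨c, hc⟩ := hpow_eq k
  have hxk : (1 + (p ^ 2 : ℤ_[p]) • x) ^ k = (c : ℤ_[p]) • (1 + (s k * p ^ 2) • x) := by
    have hω : QuadraticAlgebra.lift ⟨x, hx⟩ QuadraticAlgebra.omega = x := by
      simp [QuadraticAlgebra.lift]
    simpa only [map_pow, map_add, map_one, map_smul, hω] using
      congrArg (QuadraticAlgebra.lift ⟨x, hx⟩) hc
  have h := hsmul ↑c⁻¹ _ (hpow k)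
  rwa [hxk, map_smul, smul_smul, c.inv_mul, one_smul, map_add, map_smul] at h

open Matrix

theorem mul_self_eq_smul_add_smul {R : Type*} [CommRing R] (A : Matrix (Fin 2) (Fin 2) R) :
    A * A = (-A.det) • 1 + A.trace • A := by
  ext i j
  fin_cases i <;> fin_cases j <;>
    simp [mul_apply, Fin.sum_univ_two, det_fin_two, trace_fin_two] <;> ring

theorem exists_pow_eq_smul_add_smul {R : Type*} [CommRing R] (A : Matrix (Fin 2) (Fin 2) R)
    (n : ℕ) : ∃ a b : R, A ^ n = a • 1 + b • A := by
  induction n with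
  | zero => exact ⟨1, 0, by simp⟩
  | succ n ih =>
    obtain ⟨a, b, h⟩ := ih
    refine ⟨b * -A.det, a + b * A.trace, ?_⟩
    rw [pow_succ, h, add_mul, smul_mul_assoc, smul_mul_assoc, one_mul,
      mul_self_eq_smul_add_smul]
    module

theorem exists_pow_eq_one_add_smul {ι : Type*} [Fintype ι] [DecidableEq ι]
    {A : Matrix ι ι ℤ_[p]} (hA : IsUnit A) (n : ℕ) :
    ∃ K ≠ 0, ∃ F : Matrix ι ι ℤ_[p], A ^ K = 1 + (p ^ n : ℤ_[p]) • F := by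
  have : NeZero (p ^ n) := ⟨pow_ne_zero n (Fact.out : p.Prime).ne_zero⟩
  let reduction := (PadicInt.toZModPow (p := p) n).mapMatrix (m := ι)
  obtain ⟨u, hu⟩ := hA.map reduction
  have hker : reduction (A ^ orderOf u - 1) = 0 := by
    rw [map_sub, map_pow, map_one, ← hu, ← Units.val_pow_eq_pow_val, pow_orderOf_eq_one,
      Units.val_one, sub_self]
  have hdvd (i j : ι) : (p ^ n : ℤ_[p]) ∣ (A ^ orderOf u - 1) i j := by
    rw [← Ideal.mem_span_singleton, ← PadicInt.ker_toZModPow]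
    exact congrFun₂ hker i j
  choose F hF using hdvd
  exact ⟨orderOf u, (orderOf_pos u).ne', .of F,
    eq_add_of_sub_eq' (Matrix.ext hF)⟩

theorem exists_int_norm_lt {x y : Fin 2 → ℚ_[p]} (hxy : LinearIndependent ℚ_[p] ![x, y]) :
    ∃ c d : ℤ, ‖c * x 0 + d * x 1‖ < ‖c * y 0 + d * y 1‖ := by
  have hdet : -x 1 * y 0 + x 0 * y 1 ≠ 0 := by
    have h : IsUnit (Matrix.of ![x, y]) := linearIndependent_rows_iff_isUnit.mp hxy
    rw [isUnit_iff_isUnit_det, isUnit_iff_ne_zero, det_fin_two] at h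
    change x 0 * y 1 - x 1 * y 0 ≠ 0 at h
    contrapose! h
    linear_combination h
  obtain ⟨⟨r, s⟩, hrs⟩ :=
    ((Padic.denseRange_ratCast p).prodMap (Padic.denseRange_ratCast p)).exists_mem_open
      (isOpen_lt (f := fun z : ℚ_[p] × ℚ_[p] => ‖z.1 * x 0 + z.2 * x 1‖)
        (g := fun z => ‖z.1 * y 0 + z.2 * y 1‖) (by fun_prop) (by fun_prop))
      ⟨(-x 1, x 0), by simpa [mul_comm (x 0)] using hdet⟩
  have clear_denominators (v : Fin 2 → ℚ_[p]) :
      ((r.num * s.den : ℤ) * v 0 + (s.num * r.den : ℤ) * v 1 : ℚ_[p]) =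
        (r.den * s.den) * (r * v 0 + s * v 1) := by
    have hr : (r.num : ℚ_[p]) = r * r.den := mod_cast (Rat.mul_den_eq_num r).symm
    have hs : (s.num : ℚ_[p]) = s * s.den := mod_cast (Rat.mul_den_eq_num s).symm
    push_cast
    rw [hr, hs]
    ring
  have hden : 0 < ‖(r.den * s.den : ℚ_[p])‖ := by simp
  refine ⟨r.num * s.den, s.num * r.den, ?_⟩
  rw [clear_denominators, clear_denominators, norm_mul, norm_mul (_ * _)]
  exact mul_lt_mul_of_pos_left hrs hden

theorem exists_int_relation {x y : Fin 2 → ℚ_[p]} (hxy : LinearIndependent ℚ_[p] ![x, y]) :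
    ∃ (t : ℤ_[p]) (c d : ℤ), (c, d) ≠ (0, 0) ∧ c * (x + t • y) 0 + d * (x + t • y) 1 = 0 := by
  obtain ⟨c, d, hlt⟩ := exists_int_norm_lt hxy
  have hy : c * y 0 + d * y 1 ≠ 0 := norm_pos_iff.mp ((norm_nonneg _).trans_lt hlt)
  let t : ℤ_[p] := ⟨-((c * x 0 + d * x 1) / (c * y 0 + d * y 1)), by
    rw [norm_neg, norm_div]
    exact div_le_one_of_le₀ hlt.le (norm_nonneg _)⟩
  have ht : (t : ℚ_[p]) * (c * y 0 + d * y 1) = -(c * x 0 + d * x 1) := by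
    rw [neg_mul, div_mul_cancel₀ _ hy]
  refine ⟨t, c, d, ?_, ?_⟩
  · rintro ⟨⟩
    simp at hy
  · change c * (x 0 + t * y 0) + d * (x 1 + t * y 1) = 0
    linear_combination ht

variable (p) in
/-- A matrix over `ℤ_p` viewed over `ℚ_p`. -/
noncomputable def toQp : Matrix (Fin 2) (Fin 2) ℤ_[p] →ₐ[ℤ_[p]] Matrix (Fin 2) (Fin 2) ℚ_[p] :=
  (Algebra.ofId ℤ_[p] ℚ_[p]).mapMatrix

theorem exists_pow_eq_one_add_smul_and_linearIndependent {A : Matrix (Fin 2) (Fin 2) ℤ_[p]}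
    (hA : IsUnit A) (hpow : ∀ n ≠ 0, A ^ n ∉ Set.range (scalar (Fin 2))) {v : Fin 2 → ℚ_[p]}
    (hv : LinearIndependent ℚ_[p] ![v, v ᵥ* toQp p A]) :
    ∃ (K : ℕ) (F : Matrix (Fin 2) (Fin 2) ℤ_[p]), A ^ K = 1 + (p ^ 2 : ℤ_[p]) • F ∧
      LinearIndependent ℚ_[p] ![v, (p ^ 2 : ℤ_[p]) • (v ᵥ* toQp p F)] := by
  obtain ⟨K, hK, F, hF⟩ := exists_pow_eq_one_add_smul hA 2
  refine ⟨K, F, hF, ?_⟩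
  obtain ⟨a, b, hab⟩ := exists_pow_eq_smul_add_smul A K
  have hb : b ≠ 0 := by
    rintro rfl
    refine hpow K hK ⟨a, ?_⟩
    rw [hab, zero_smul, add_zero, scalar_apply, smul_one_eq_diagonal]
  have hvF : (p ^ 2 : ℤ_[p]) • (v ᵥ* toQp p F) = (a - 1) • v + b • (v ᵥ* toQp p A) := by
    have h : (p ^ 2 : ℤ_[p]) • F = (a - 1) • 1 + b • A := by
      rw [sub_smul, one_smul, sub_add_eq_add_sub, ← hab, hF, add_sub_cancel_left]
    rw [← vecMul_smul, ← map_smul, h, map_add, map_smul, map_smul, map_one, vecMul_add,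
      vecMul_smul, vecMul_smul, vecMul_one]
  rw [hvF]
  simpa only [one_smul, zero_smul, add_zero] using
    (LinearIndependent.pair_add_smul_add_smul_iff 1 0 (a - 1) b).mpr ⟨hv, by simpa using hb⟩

theorem exists_vecMul_eq_smul {A : Matrix (Fin 2) (Fin 2) ℤ_[p]} (hA : IsUnit A)
    (hpow : ∀ n ≠ 0, A ^ n ∉ Set.range (scalar (Fin 2))) {C : Set (Fin 2 → ℚ_[p])}
    (hC : IsClosed C) (hsmul : ∀ c : ℤ_[p], ∀ v ∈ C, c • v ∈ C)
    (hAC : ∀ v ∈ C, v ᵥ* toQp p A ∈ C)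
    (hrat : ∀ v ∈ C, ∀ c d : ℤ, (c, d) ≠ (0, 0) → c * v 0 + d * v 1 = 0 → v = 0)
    {v : Fin 2 → ℚ_[p]} (hv : v ∈ C) : ∃ l : ℚ_[p], v ᵥ* toQp p A = l • v := by
  by_contra! h
  have hv0 : v ≠ 0 := fun hv0 => h 0 (by simp [hv0])
  obtain ⟨K, F, hF, hind⟩ := exists_pow_eq_one_add_smul_and_linearIndependent hA hpow
    ((LinearIndependent.pair_iff' hv0).mpr fun l => (h l).symm)
  have horbit (n : ℕ) : v ᵥ* toQp p (A ^ n) ∈ C := by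
    induction n with
    | zero => simpa using hv
    | succ n ih => simpa [pow_succ] using hAC _ ih
  have harc (t : ℤ_[p]) : v + t • (p ^ 2 : ℤ_[p]) • (v ᵥ* toQp p F) ∈ C := by
    have : ContinuousSMul ℤ_[p] ℚ_[p] := continuousSMul_of_algebraMap _ _ continuous_subtype_val
    let L := vecMulBilin ℤ_[p] ℤ_[p] v ∘ₗ (toQp p).toLinearMap
    have h := add_smul_mem_of_one_add_smul_pow_mem hC hsmul (mul_self_eq_smul_add_smul F) L
      (fun k => by rw [← hF, ← pow_mul]; exact horbit _) t
    simpa [L, smul_smul] using h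
  obtain ⟨t, c, d, hcd, hrel⟩ := exists_int_relation hind
  have hzero : (1 : ℚ_[p]) • v + (t : ℚ_[p]) • (p ^ 2 : ℤ_[p]) • (v ᵥ* toQp p F) = 0 := by
    rw [one_smul]
    exact hrat _ (harc t) c d hcd hrel
  exact one_ne_zero (LinearIndependent.pair_iff.mp hind 1 t hzero).1

variable (p) in
/-- The matrix `A_{w_n}` of the prefix `w_n` of `w`, over `ℤ_p`. -/
noncomputable def prefixMatrix (w : Word) (n : ℕ) : Matrix (Fin 2) (Fin 2) ℤ_[p] :=
  (wordMatrix (wordPrefix w n)).map Int.cast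

theorem shift_iterate_apply (w : Word) (m i : ℕ) : shift^[m] w i = w (m + i) := by
  induction m generalizing w with
  | zero => simp
  | succ m ih =>
    rw [Function.iterate_succ_apply, ih, shift]
    congr 1
    omega

theorem wordPrefix_add (w : Word) (m n : ℕ) :
    wordPrefix w (m + n) = wordPrefix w m ++ wordPrefix (shift^[m] w) n := by
  simp [wordPrefix, List.range_add, Function.comp_def, shift_iterate_apply]

theorem prefixMatrix_zero (w : Word) : prefixMatrix p w 0 = 1 := by
  simp [prefixMatrix, wordPrefix, wordMatrix]

theorem prefixMatrix_one (w : Word) : prefixMatrix p w 1 = !![0, 1; 1, (w 0 : ℤ_[p])] := by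
  ext i j
  fin_cases i <;> fin_cases j <;> simp [prefixMatrix, wordPrefix, wordMatrix, letterMatrix]

theorem prefixMatrix_add (w : Word) (m n : ℕ) :
    prefixMatrix p w (m + n) = prefixMatrix p w m * prefixMatrix p (shift^[m] w) n := by
  simp only [prefixMatrix, wordPrefix_add, wordMatrix, List.map_append, List.prod_append]
  exact Matrix.map_mul_intCast _ _

theorem det_prefixMatrix (w : Word) (n : ℕ) : (prefixMatrix p w n).det = (-1) ^ n := by
  induction n with
  | zero => simp [prefixMatrix_zero]
  | succ n ih =>
    rw [prefixMatrix_add, det_mul, ih, prefixMatrix_one, det_fin_two_of, pow_succ]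
    ring

theorem isUnit_of_mem_Vp {w : Word} {A : Matrix (Fin 2) (Fin 2) ℤ_[p]} (hA : A ∈ Vp p w) :
    IsUnit A := by
  have hclosed : IsClosed {A : Matrix (Fin 2) (Fin 2) ℤ_[p] | A.det ^ 2 = 1} :=
    isClosed_eq (continuous_id.matrix_det.pow 2) continuous_const
  have hsub : Vpn p 1 w ⊆ {A | A.det ^ 2 = 1} := by
    rintro _ ⟨m, -, rfl⟩
    change (prefixMatrix p w m).det ^ 2 = 1
    rw [det_prefixMatrix, pow_right_comm, neg_one_sq, one_pow]
  have hdet : A.det ^ 2 = 1 := closure_minimal hsub hclosed (Set.mem_iInter₂.mp hA 1 le_rfl)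
  exact (isUnit_iff_isUnit_det A).mpr (IsUnit.of_pow_eq_one hdet two_ne_zero)

variable (p) in
/-- The vectors that satisfy the inequalities which define `PBadEps`; unlike `PBadEps` this is a
subset of `ℚ_p²`, and it contains `0`. -/
def badVectors (ε : ℝ) : Set (Fin 2 → ℚ_[p]) :=
  {v | ∀ a b : ℤ, (a, b) ≠ (0, 0) →
    ε * max ‖v 0‖ ‖v 1‖ ≤ ‖a * v 0 + b * v 1‖ * max |(a : ℝ)| |(b : ℝ)| ^ 2}

theorem isClosed_badVectors (ε : ℝ) : IsClosed (badVectors p ε) := by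
  simp only [badVectors, Set.ofPred_forall]
  exact isClosed_iInter fun a => isClosed_iInter fun b => isClosed_iInter fun _ =>
    isClosed_le (by fun_prop) (by fun_prop)

theorem smul_mem_badVectors {ε : ℝ} {v : Fin 2 → ℚ_[p]} (hv : v ∈ badVectors p ε) (c : ℚ_[p]) :
    c • v ∈ badVectors p ε := by
  intro a b hab
  simp only [Pi.smul_apply, smul_eq_mul, mul_left_comm _ c, ← mul_add, norm_mul,
    ← mul_max_of_nonneg _ _ (norm_nonneg c), mul_left_comm ε, mul_assoc]
  exact mul_le_mul_of_nonneg_left (hv a b hab) (norm_nonneg c)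

theorem eq_zero_of_mem_badVectors {ε : ℝ} (hε : 0 < ε) {v : Fin 2 → ℚ_[p]}
    (hv : v ∈ badVectors p ε) {a b : ℤ} (hab : (a, b) ≠ (0, 0)) (h : a * v 0 + b * v 1 = 0) :
    v = 0 := by
  have hmax : max ‖v 0‖ ‖v 1‖ ≤ 0 :=
    nonpos_of_mul_nonpos_right (by simpa only [h, norm_zero, zero_mul] using hv a b hab) hε
  rw [max_le_iff, norm_le_zero_iff, norm_le_zero_iff] at hmax
  ext i
  fin_cases i
  exacts [hmax.1, hmax.2]

theorem letterMap_eq_vecMul (w : Word) (v : Fin 2 → ℚ_[p]) :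
    letterMap p (w 0) v = v ᵥ* toQp p (prefixMatrix p w 1) := by
  rw [prefixMatrix_one]
  ext i
  fin_cases i <;> simp [letterMap, letterMatrix, toQp, mulVec, vecMul, dotProduct, mul_comm]

theorem extShift_iterate (w : Word) {v : Fin 2 → ℚ_[p]} (hv : v ≠ 0) (n : ℕ) :
    ∃ hn : v ᵥ* toQp p (prefixMatrix p w n) ≠ 0,
      (extShift p)^[n] (w, .mk ℚ_[p] v hv) = (shift^[n] w, .mk ℚ_[p] _ hn) := by
  induction n with
  | zero => simpa [prefixMatrix_zero] using hv
  | succ n ih =>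
    obtain ⟨hn, ih⟩ := ih
    have hstep : letterMap p (shift^[n] w 0) (v ᵥ* toQp p (prefixMatrix p w n)) =
        v ᵥ* toQp p (prefixMatrix p w (n + 1)) := by
      rw [letterMap_eq_vecMul, vecMul_vecMul, ← map_mul, ← prefixMatrix_add]
    refine ⟨hstep ▸ (map_ne_zero_iff _ (letterMap_injective p _)).mpr hn, ?_⟩
    simp only [Function.iterate_succ_apply', ih, extShift, Projectivization.map_mk, hstep]

variable (p) in
/-- The vectors that span a point `x_p` such that `T^n (w, x_p)`, `n = 1, 2, …`, have their second
member in `PBad_ε`, together with `0`. -/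
def badOrbitVectors (w : Word) (ε : ℝ) : Set (Fin 2 → ℚ_[p]) :=
  {v | ∀ n ≥ 1, v ᵥ* toQp p (prefixMatrix p w n) ∈ badVectors p ε}

theorem mem_badOrbitVectors_iff {w : Word} {ε : ℝ} {v : Fin 2 → ℚ_[p]} (hv : v ≠ 0) :
    v ∈ badOrbitVectors p w ε ↔
      ∀ n ≥ 1, ((extShift p)^[n] (w, .mk ℚ_[p] v hv)).2 ∈ PBadEps p ε := by
  refine forall₂_congr fun n _ => ?_
  obtain ⟨hn, heq⟩ := extShift_iterate w hv n
  rw [heq]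
  exact (mk_mem_PBadEps_iff p ε _ hn).symm

theorem isClosed_badOrbitVectors (w : Word) (ε : ℝ) : IsClosed (badOrbitVectors p w ε) := by
  simp only [badOrbitVectors, Set.ofPred_forall]
  exact isClosed_iInter fun n => isClosed_iInter fun _ =>
    (isClosed_badVectors ε).preimage (continuous_id.matrix_vecMul continuous_const)

theorem smul_mem_badOrbitVectors {w : Word} {ε : ℝ} {v : Fin 2 → ℚ_[p]}
    (hv : v ∈ badOrbitVectors p w ε) (c : ℚ_[p]) : c • v ∈ badOrbitVectors p w ε := by
  intro n hn
  rw [smul_vecMul]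
  exact smul_mem_badVectors (hv n hn) c

theorem eq_zero_of_mem_badOrbitVectors {w : Word} {ε : ℝ} (hε : 0 < ε) {v : Fin 2 → ℚ_[p]}
    (hv : v ∈ badOrbitVectors p w ε) {c d : ℤ} (hcd : (c, d) ≠ (0, 0))
    (h : c * v 0 + d * v 1 = 0) : v = 0 := by
  have hv1 : letterMap p (w 0) v ∈ badVectors p ε := letterMap_eq_vecMul w v ▸ hv 1 le_rfl
  have happ : letterMap p (w 0) v = ![v 1, v 0 + (w 0 : ℤ) * v 1] := by
    ext i
    fin_cases i <;> simp [letterMap, letterMatrix, mulVec, dotProduct]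
  have hne : (d - c * (w 0 : ℤ), c) ≠ (0, 0) := by
    contrapose! hcd
    aesop
  refine (map_eq_zero_iff _ (letterMap_injective p (w 0))).mp
    (eq_zero_of_mem_badVectors hε hv1 hne ?_)
  rw [happ, cons_val_zero, cons_val_one]
  push_cast
  linear_combination h

theorem vecMul_mem_badOrbitVectors {w : Word} {ε : ℝ} {A : Matrix (Fin 2) (Fin 2) ℤ_[p]}
    (hA : A ∈ Vp p w) {v : Fin 2 → ℚ_[p]} (hv : v ∈ badOrbitVectors p w ε) :
    v ᵥ* toQp p A ∈ badOrbitVectors p w ε := by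
  intro n hn
  have hcont : Continuous fun A => v ᵥ* toQp p A ᵥ* toQp p (prefixMatrix p w n) :=
    (continuous_const.matrix_vecMul (continuous_id.matrix_map continuous_subtype_val)).matrix_vecMul
      continuous_const
  have hsub : Vpn p n w ⊆
      {A | v ᵥ* toQp p A ᵥ* toQp p (prefixMatrix p w n) ∈ badVectors p ε} := by
    rintro _ ⟨m, hm, rfl⟩
    have hn_eq : prefixMatrix p w n = prefixMatrix p (shift^[m] w) n := by
      rw [prefixMatrix, prefixMatrix, hm]
    change v ᵥ* toQp p (prefixMatrix p w m) ᵥ* toQp p (prefixMatrix p w n) ∈ badVectors p ε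
    rw [hn_eq, vecMul_vecMul, ← map_mul, ← prefixMatrix_add]
    exact hv (m + n) (by omega)
  exact closure_minimal hsub ((isClosed_badVectors ε).preimage hcont)
    (Set.mem_iInter₂.mp hA n hn)

theorem exists_vecMul_eq_smul_of_mem_Vp {w : Word} {A : Matrix (Fin 2) (Fin 2) ℤ_[p]}
    (hA : ∀ n ≠ 0, A ^ n ∉ Set.range (scalar (Fin 2))) (hV : A ∈ Vp p w) {ε : ℝ} (hε : 0 < ε)
    {v : Fin 2 → ℚ_[p]} (hv : v ∈ badOrbitVectors p w ε) :
    ∃ l : ℚ_[p], v ᵥ* toQp p A = l • v :=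
  exists_vecMul_eq_smul (isUnit_of_mem_Vp hV) hA (isClosed_badOrbitVectors w ε)
    (fun c _ hu => smul_mem_badOrbitVectors hu c)
    (fun _ hu => vecMul_mem_badOrbitVectors hV hu)
    (fun _ hu _ _ => eq_zero_of_mem_badOrbitVectors hε hu) hv

theorem mk_mem_eigenpoints {A : Matrix (Fin 2) (Fin 2) ℤ_[p]} {r : Fin 2 → PadicAlgCl p}
    (hr : r ≠ 0) {l : PadicAlgCl p} (h : endAlgCl A r = l • r) :
    Projectivization.mk (PadicAlgCl p) r hr ∈ eigenpoints A := by
  obtain ⟨c, hc⟩ := Projectivization.exists_smul_eq_mk_rep (PadicAlgCl p) r hr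
  refine ⟨l, Module.End.hasEigenvector_iff.mpr
    ⟨Module.End.mem_eigenspace_iff.mpr ?_, Projectivization.rep_nonzero _⟩⟩
  rw [← hc, Units.smul_def, map_smul, h, smul_comm]

theorem mulVec_eq_smul_of_vecMul_eq_smul {R : Type*} [CommRing R] {A : Matrix (Fin 2) (Fin 2) R}
    {v : Fin 2 → R} {l : R} (h : v ᵥ* A = l • v) :
    A *ᵥ ![-v 1, v 0] = (A.trace - l) • ![-v 1, v 0] := by
  have h0 := congrFun h 0
  have h1 := congrFun h 1
  simp only [vecMul, dotProduct, Fin.sum_univ_two, Pi.smul_apply, smul_eq_mul] at h0 h1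
  refine funext (Fin.forall_fin_two.mpr ⟨?_, ?_⟩) <;>
    simp only [mulVec, dotProduct, Fin.sum_univ_two, cons_val_zero, cons_val_one, trace_fin_two,
      Pi.smul_apply, smul_eq_mul]
  · linear_combination h1
  · linear_combination -h0

theorem exists_mem_eigenpoints_of_vecMul_eq_smul {v : Fin 2 → ℚ_[p]} (hv : v ≠ 0) :
    ∃ P, ∀ A : Matrix (Fin 2) (Fin 2) ℤ_[p], (∃ l : ℚ_[p], v ᵥ* toQp p A = l • v) →
      P ∈ eigenpoints A := by
  let f := algebraMap ℚ_[p] (PadicAlgCl p)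
  have hr : f ∘ ![-v 1, v 0] ≠ 0 := by
    contrapose! hv
    ext i
    fin_cases i
    · simpa [f] using congrFun hv 1
    · simpa [f] using congrFun hv 0
  refine ⟨.mk _ _ hr, fun A ⟨l, hl⟩ =>
    mk_mem_eigenpoints hr (l := f ((toQp p A).trace - l)) ?_⟩
  ext i
  calc endAlgCl A (f ∘ ![-v 1, v 0]) i = f ((toQp p A *ᵥ ![-v 1, v 0]) i) :=
      (f.map_mulVec (toQp p A) _ i).symm
    _ = (f ((toQp p A).trace - l) • f ∘ ![-v 1, v 0]) i := by
      rw [mulVec_eq_smul_of_vecMul_eq_smul hl, Pi.smul_apply, smul_eq_mul, map_mul]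
      rfl

end PLC

theorem corollary6p2_general {p : ℕ} [Fact p.Prime] {w : PLC.Word}
    {A₁ A₂ : Matrix (Fin 2) (Fin 2) ℤ_[p]}
    (hA₁ : ∀ n ≠ 0, A₁ ^ n ∉ Set.range (Matrix.scalar (Fin 2)))
    (hA₂ : ∀ n ≠ 0, A₂ ^ n ∉ Set.range (Matrix.scalar (Fin 2)))
    (hdisj : Disjoint (PLC.eigenpoints A₁) (PLC.eigenpoints A₂))
    (hV₁ : A₁ ∈ PLC.Vp p w) (hV₂ : A₂ ∈ PLC.Vp p w) (xp : PLC.ProjLine p) {ε : ℝ} (hε : 0 < ε) :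
    ∃ n ≥ 1, ((PLC.extShift p)^[n] (w, xp)).2 ∉ PLC.PBadEps p ε := by
  by_contra! hbad
  induction xp using Projectivization.ind with
  | h v hv =>
    have hv_mem := (PLC.mem_badOrbitVectors_iff hv).mpr hbad
    obtain ⟨P, hP⟩ := PLC.exists_mem_eigenpoints_of_vecMul_eq_smul hv
    exact Set.disjoint_left.mp hdisj
      (hP A₁ (PLC.exists_vecMul_eq_smul_of_mem_Vp hA₁ hV₁ hε hv_mem))
      (hP A₂ (PLC.exists_vecMul_eq_smul_of_mem_Vp hA₂ hV₂ hε hv_mem))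

theorem corollary6p2 (p : ℕ) [Fact p.Prime] (N : ℕ) (w : PLC.Word) (hw : w ∈ PLC.words N)
    (A₁ A₂ : Matrix (Fin 2) (Fin 2) ℤ_[p])
    (hA₁ : A₁ ∈ PLC.SLtilde p) (hA₂ : A₂ ∈ PLC.SLtilde p)
    (hdisj : Disjoint (PLC.eigenpoints A₁) (PLC.eigenpoints A₂))
    (hV₁ : A₁ ∈ PLC.Vp p w) (hV₂ : A₂ ∈ PLC.Vp p w)
    (xp : PLC.ProjLine p) :
    (w, xp) ∉ PLC.LMad p := by
  rintro ⟨ε, hε, hmem⟩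
  obtain ⟨n, hn, hbad⟩ := corollary6p2_general
    (fun _ => PLC.pow_notMem_range_scalar_of_mem_SLtilde hA₁)
    (fun _ => PLC.pow_notMem_range_scalar_of_mem_SLtilde hA₂) hdisj hV₁ hV₂ xp hε
  exact hbad (hmem n hn).2
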